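/- For $n\ge 1$ let $B_n$ be the braid group on $n$ strands, with generators $\sigma_1,\dots,\sigma_{n-1}$ and relations $\sigma_i\sigma_{i+1}\sigma_i=\sigma_{i+1}\sigma_i\sigma_{i+1}$ for $1\le i<n-1$ and $\sigma_i\sigma_j=\sigma_j\sigma_i$ for $|i-j|>1$. Let $S_k$ be the symmetric group on $k$ letters, and let $\pi:B_n\to S_n$ be the standard projection, $\pi(\sigma_i)=(i,i+1)$. A homomorphism is called cyclic if its image is a cyclic group, and two homomorphisms $f,g:G\to H$ are called conjugate if there is $s\in H$ with $f(x)=s\,g(x)\,s^{-1}$ for all $x\in G$. 1. Let $n\ge 3$ with $n\ne 4,6$. A homomorphism $f:B_n\to S_n$ is non-cyclic if and only if it is conjugate to $\pi$. 2. Let $n\ge 3$ with $n\ne 4$. For every $k<n$, every homomorphism $B_n\to S_k$ is cyclic. 3. There is exactly one automorphism $\alpha$ of $S_6$ with $\alpha((1,2))=(1,2)(3,4)(5,6)$ and $\alpha((1,2,3,4,5,6))=(1,2,3)(4,5)$. It is not inner, and every non-inner automorphism of $S_6$ is conjugate to $\alpha$. A homomorphism $f:B_6\to S_6$ is non-cyclic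 if and only if it is conjugate to $\pi$ or to $\alpha\circ\pi$; and $\alpha\circ\pi$ is not conjugate to $\pi$. -/

import Mathlib

/-- The relators of the Artin presentation on generators `σ_0, …, σ_{n-2}`:
`σ_i σ_{i+1} σ_i = σ_{i+1} σ_i σ_{i+1}`, and `σ_i σ_j = σ_j σ_i` if `|i - j| > 1`. -/
def braidRels (n : ℕ) : Set (FreeGroup (Fin (n - 1))) :=
  {r | ∃ i j : Fin (n - 1), (i : ℕ) + 1 = j ∧
      r = FreeGroup.of i * FreeGroup.of j * FreeGroup.of i *
        (FreeGroup.of j * FreeGroup.of i * FreeGroup.of j)⁻¹} ∪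
  {r | ∃ i j : Fin (n - 1), ((i : ℕ) + 1 < j ∨ (j : ℕ) + 1 < i) ∧
      r = FreeGroup.of i * FreeGroup.of j * (FreeGroup.of j * FreeGroup.of i)⁻¹}

/-- The braid group `B_n` on `n` strands, by the Artin presentation. -/
abbrev BraidGroup (n : ℕ) : Type := PresentedGroup (braidRels n)

/-- The adjacent transposition `(i, i+1)` of the `n` letters `0, …, n-1`. -/
def adjSwap (n : ℕ) (i : Fin (n - 1)) : Equiv.Perm (Fin n) :=
  Equiv.swap ⟨i, by omega⟩ ⟨i + 1, by omega⟩

theorem adjSwap_rels (n : ℕ) :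
    ∀ r ∈ braidRels n, FreeGroup.lift (adjSwap n) r = 1 := by
  rintro r (⟨i, j, hij, rfl⟩ | ⟨i, j, hij, rfl⟩) <;>
  · simp only [map_mul, map_inv, FreeGroup.lift_apply_of, mul_inv_eq_one]
    ext x
    simp only [adjSwap, Equiv.Perm.mul_apply, Equiv.swap_apply_def, Fin.ext_iff]
    grind

/-- The standard projection `π : B_n → S_n`, sending `σ_i` to the transposition `(i, i+1)`. -/
def braidProj (n : ℕ) : BraidGroup n →* Equiv.Perm (Fin n) :=
  PresentedGroup.toGroup (adjSwap_rels n)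

/-- Two homomorphisms into `H` are conjugate if they differ by an inner automorphism of `H`. -/
def ConjHom {G H : Type*} [Group G] [Group H] (f g : G →* H) : Prop :=
  ∃ s : H, ∀ x : G, f x = s * g x * s⁻¹

/-- A homomorphism is cyclic if its image is a cyclic group. -/
def CyclicHom {G H : Type*} [Group G] [Group H] (f : G →* H) : Prop :=
  IsCyclic f.range

/-- An automorphism is inner if it is conjugation by an element. -/
def IsInnerAut {G : Type*} [Group G] (α : MulAut G) : Prop :=
  ∃ s : G, α = MulAut.conj s

/-! A homomorphism from `B_n` is a sequence of `m = n - 1` elements satisfying the braid relations.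
It is cyclic exactly when the first two elements agree, since commuting elements satisfying the
braid relation are equal and one such collapse spreads along the sequence. Everything thus reduces
to braid sequences of permutations with `x 0 ≠ x 1`.

The core is `BraidSeq.cycleType_zero`: for `m ≥ 4` and at most `m + 1` letters, such an `x 0` is a
transposition, or `m = 5` and it is a product of three disjoint ones. For `m = 4, 5` the elements `x
2`, `x 3` lie in the centralizer of `x 0`, and for every other cycle type this centralizer is too
close to nilpotent to contain distinct conjugates of `x 0` satisfying the braid relation. For larger
`m`, induct in steps of two: the shorter sequence `x 2, x 3, …` acts on the cycles and on the fixed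
points of `x 0`. If both actions are constant, the sequence collapses; so `x 0` has too many fixed
points to move more than two letters.

Transpositions forming a non-constant braid sequence are a chain `(p i, p (i+1))` with distinct
letters (`exists_chain`). With `n` letters, `p` is the conjugator to `π`; with fewer, there is no
room for it. In `S_6` an outer automorphism, built from the action on the six one-factorizations of
the complete graph, exchanges the remaining cycle type with transpositions. Composing with it
reduces the exceptional case to the standard one, and the statement on outer automorphisms follows
because `π` is surjective. -/

/-! ### Braid sequences and how they collapse -/

/-- The elements `x 0, …, x (m - 1)` satisfy the braid relations on `m` generators. -/
structure BraidSeq {G : Type*} [Group G] (m : ℕ) (x : ℕ → G) : Prop where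
  braid : ∀ i, i + 1 < m → x i * x (i + 1) * x i = x (i + 1) * x i * x (i + 1)
  comm : ∀ i j, i + 1 < j → j < m → Commute (x i) (x j)

theorem eq_of_braid_of_commute {G : Type*} [Group G] {a b : G}
    (h : a * b * a = b * a * b) (hc : Commute a b) : a = b := by
  rw [hc.eq] at h
  exact mul_left_cancel h

/-- Induction along central quotients: if `a` and `b` agree modulo the center, then `a⁻¹ * b` is
central, so they commute, and commuting elements with the braid relation are equal. -/
theorem eq_of_braid_of_isNilpotent (G : Type*) [Group G] [Group.IsNilpotent G] :
    ∀ a b : G, a * b * a = b * a * b → a = b := by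
  refine Group.nilpotent_center_quotient_ind
    (P := fun G _ _ => ∀ a b : G, a * b * a = b * a * b → a = b) G ?_ ?_
  · intro G _ _ a b _
    exact Subsingleton.elim a b
  · intro G _ _ ih a b h
    have h1 : (a : G ⧸ Subgroup.center G) = b := ih a b (by exact_mod_cast congrArg _ h)
    have hz := Subgroup.mem_center_iff.1 (QuotientGroup.eq.1 h1)
    refine eq_of_braid_of_commute h ?_
    have := hz a
    rw [mul_inv_cancel_left, mul_assoc] at this
    exact eq_inv_mul_iff_mul_eq.1 this

namespace BraidSeq

variable {G H : Type*} [Group G] [Group H] {m : ℕ} {x : ℕ → G}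

theorem map (hx : BraidSeq m x) (f : G →* H) : BraidSeq m (fun i => f (x i)) where
  braid i hi := by simp only [← map_mul, hx.braid i hi]
  comm i j hij hj := (hx.comm i j hij hj).map f

theorem shift {k : ℕ} (hx : BraidSeq (m + k) x) : BraidSeq m (fun i => x (i + k)) where
  braid i hi := by
    have := hx.braid (i + k) (by omega)
    rwa [show i + k + 1 = i + 1 + k by omega] at this
  comm i j hij hj := hx.comm _ _ (by omega) (by omega)

theorem exists_lift (hx : BraidSeq m x) (K : Subgroup G) (hK : ∀ i < m, x i ∈ K) :
    ∃ z : ℕ → K, BraidSeq m z ∧ ∀ i < m, (z i : G) = x i := by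
  -- Beyond the first `m` indices the lift takes the junk value `1`, which no relation sees.
  have hz : ∀ i (h : i < m),
      ((if h : i < m then ⟨x i, hK i h⟩ else 1 : K) : G) = x i := fun i h => by rw [dif_pos h]
  refine ⟨fun i => if h : i < m then ⟨x i, hK i h⟩ else 1, ⟨fun i hi => ?_, fun i j hij hj => ?_⟩,
    hz⟩
  · apply Subtype.ext
    simp only [Subgroup.coe_mul, hz i (by omega), hz (i + 1) hi, hx.braid i hi]
  · apply Subtype.ext
    simp only [Subgroup.coe_mul, hz i (by omega), hz j hj, (hx.comm i j hij hj).eq]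

theorem succ_eq_iff (hx : BraidSeq m x) {i : ℕ} (hi : i + 2 < m) :
    x i = x (i + 1) ↔ x (i + 1) = x (i + 2) := by
  have hc := hx.comm i (i + 2) (by omega) hi
  constructor <;> intro h
  · exact eq_of_braid_of_commute (hx.braid (i + 1) hi) (h ▸ hc)
  · exact eq_of_braid_of_commute (hx.braid i (by omega)) (h ▸ hc)

theorem succ_eq_iff_zero_eq_one (hx : BraidSeq m x) {i : ℕ} (hi : i + 1 < m) :
    x i = x (i + 1) ↔ x 0 = x 1 := by
  induction i with
  | zero => rfl
  | succ i ih => exact (hx.succ_eq_iff hi).symm.trans (ih (by omega))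

theorem eq_zero (hx : BraidSeq m x) (h : x 0 = x 1) {i : ℕ} (hi : i < m) : x i = x 0 := by
  induction i with
  | zero => rfl
  | succ i ih => rw [← (hx.succ_eq_iff_zero_eq_one hi).2 h, ih (by omega)]

/-- Some neighbour of one of the two equal elements is far from the other, hence commutes with both,
and the braid relation collapses. For `m = 3` the indices `0, 2` have only the common neighbour `1`;
this is the exception `n = 4`. -/
theorem zero_eq_one_of_eq (hx : BraidSeq m x) (hm : m ≠ 3) {i j : ℕ} (hij : i < j) (hj : j < m)
    (h : x i = x j) : x 0 = x 1 := by
  obtain rfl | hij : j = i + 1 ∨ i + 1 < j := by omega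
  · exact (hx.succ_eq_iff_zero_eq_one hj).1 h
  by_cases hjm : j + 1 < m
  · exact (hx.succ_eq_iff_zero_eq_one hjm).1 (eq_of_braid_of_commute (hx.braid j hjm)
      (h ▸ hx.comm i (j + 1) (by omega) hjm))
  obtain _ | i := i
  · exact eq_of_braid_of_commute (hx.braid 0 (by omega))
      (h ▸ (hx.comm 1 j (by omega) hj).symm)
  · exact (hx.succ_eq_iff_zero_eq_one (i := i) (by omega)).1
      (eq_of_braid_of_commute (hx.braid i (by omega)) (h ▸ hx.comm i j (by omega) hj))

theorem isConj (hx : BraidSeq m x) {i : ℕ} (hi : i < m) : IsConj (x 0) (x i) := by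
  induction i with
  | zero => rfl
  | succ i ih =>
    refine (ih (by omega)).trans (isConj_iff.2 ⟨x i * x (i + 1), ?_⟩)
    rw [hx.braid i hi]
    group

end BraidSeq

/-! ### Braid sequences of transpositions -/

namespace BraidSeq

open Equiv

variable {X : Type*} [DecidableEq X]

/-- Two distinct transpositions satisfying the braid relation share exactly one letter. -/
theorem exists_of_swap_braid {p q : X} {b : Perm X} (hb : b.IsSwap)
    (h : swap p q * b * swap p q = b * swap p q * b) (hne : swap p q ≠ b) :
    ∃ v, v ≠ p ∧ v ≠ q ∧ (b = swap q v ∨ b = swap p v) := by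
  obtain ⟨u, v, huv, rfl⟩ := hb
  have hc : ¬ Commute (swap p q) (swap u v) := fun hc => hne (eq_of_braid_of_commute h hc)
  by_cases hup : u = p
  · subst hup
    refine ⟨v, huv.symm, ?_, Or.inr rfl⟩
    rintro rfl; exact hne rfl
  by_cases huq : u = q
  · subst huq
    refine ⟨v, ?_, huv.symm, Or.inl rfl⟩
    rintro rfl; exact hne (swap_comm _ _)
  by_cases hvp : v = p
  · subst hvp
    exact ⟨u, hup, huq, Or.inr (swap_comm _ _)⟩
  by_cases hvq : v = q
  · subst hvq
    exact ⟨u, hup, huq, Or.inl (swap_comm _ _)⟩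
  refine absurd ?_ hc
  ext y
  simp only [Perm.mul_apply, swap_apply_def]
  grind

theorem swap_ne_of_commute {p q v : X} (hpq : p ≠ q) (hvp : v ≠ p) (hvq : v ≠ q) :
    ¬ Commute (swap p q) (swap q v) := by
  intro h
  have := DFunLike.congr_fun h.eq p
  simp only [Perm.mul_apply, swap_apply_def] at this
  grind

theorem exists_chain_aux {m : ℕ} {x : ℕ → Perm X} (hx : BraidSeq (m + 2) x)
    (hs : ∀ i < m + 2, (x i).IsSwap) (hne : ∀ i j, i < j → j < m + 2 → x i ≠ x j) :
    ∃ p : ℕ → X, Set.InjOn p (Set.Iio (m + 3)) ∧ ∀ i < m + 2, x i = swap (p i) (p (i + 1)) := by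
  induction m with
  | zero =>
    obtain ⟨p, q, hpq, h0⟩ := hs 0 (by omega)
    obtain ⟨v, hvp, hvq, h1⟩ := exists_of_swap_braid (p := p) (q := q) (hs 1 (by omega))
      (by rw [← h0]; exact hx.braid 0 (by omega)) (by rw [← h0]; exact hne 0 1 (by omega) (by omega))
    -- The first transposition must be oriented so that its second letter is the shared one; both
    -- orientations are handled by this claim.
    have key : ∀ p q : X, p ≠ q → v ≠ p → v ≠ q → x 0 = swap p q → x 1 = swap q v →
        ∃ p : ℕ → X, Set.InjOn p (Set.Iio (0 + 3)) ∧
          ∀ i < 0 + 2, x i = swap (p i) (p (i + 1)) := by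
      intro p q hpq hvp hvq h0 h1
      refine ⟨fun i => if i = 0 then p else if i = 1 then q else v, ?_, ?_⟩
      · intro i hi j hj hij
        simp only [Set.mem_Iio] at hi hj
        grind
      · intro i hi
        interval_cases i <;> simpa
    rcases h1 with h1 | h1
    · exact key p q hpq hvp hvq h0 h1
    · exact key q p hpq.symm hvq hvp (h0.trans (swap_comm _ _)) h1
  | succ m ih =>
    obtain ⟨p, hp, hxp⟩ := ih ⟨fun i hi => hx.braid i (by omega), fun i j hij hj =>
      hx.comm i j hij (by omega)⟩ (fun i hi => hs i (by omega))
      (fun i j hij hj => hne i j hij (by omega))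
    have hpne : ∀ i j, i < j → j < m + 3 → p i ≠ p j := fun i j hij hj h =>
      absurd (hp (Set.mem_Iio.2 (by omega)) (Set.mem_Iio.2 hj) h) (by omega)
    have h0 := hxp (m + 1) (by omega)
    obtain ⟨v, hv1, hv2, h1⟩ := exists_of_swap_braid (p := p (m + 1)) (q := p (m + 2))
      (hs (m + 2) (by omega)) (by rw [← h0]; exact hx.braid (m + 1) (by omega))
      (by rw [← h0]; exact hne (m + 1) (m + 2) (by omega) (by omega))
    have hcm : ∀ i < m + 1, Commute (swap (p i) (p (i + 1))) (x (m + 2)) := fun i hi => by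
      rw [← hxp i (by omega)]
      exact hx.comm i (m + 2) (by omega) (by omega)
    -- Otherwise the new transposition would close a triangle, failing to commute with `x m`, or
    -- would coincide with `x m`.
    have hvm : v ≠ p m := by
      rintro rfl
      rcases h1 with h1 | h1
      · have := hcm m (by omega)
        rw [h1, swap_comm (p m) (p (m + 1)), swap_comm (p (m + 2))] at this
        exact swap_ne_of_commute hv1.symm (hpne (m + 1) (m + 2) (by omega) (by omega)).symm
          hv2.symm this
      · exact hne m (m + 2) (by omega) (by omega)
          (by rw [h1, hxp m (by omega), swap_comm])
    -- Sharing the letter `p (m + 1)` instead would prevent commuting with `x m`.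
    have h1 : x (m + 2) = swap (p (m + 2)) v := by
      rcases h1 with h1 | h1
      · exact h1
      · refine absurd (hcm m (by omega)) ?_
        rw [h1]
        exact swap_ne_of_commute (hpne m (m + 1) (by omega) (by omega)) hvm hv1
    have hv : ∀ i < m + 3, v ≠ p i := by
      intro i hi
      obtain h | rfl | rfl | rfl : i < m ∨ i = m ∨ i = m + 1 ∨ i = m + 2 := by omega
      · rintro rfl
        have := hcm i (by omega)
        rw [h1, swap_comm (p i), swap_comm (p (m + 2))] at this
        exact swap_ne_of_commute (hpne i (i + 1) (by omega) (by omega)).symm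
          (hpne (i + 1) (m + 2) (by omega) (by omega)).symm hv2.symm this
      · exact hvm
      · exact hv1
      · exact hv2
    refine ⟨Function.update p (m + 3) v, ?_, ?_⟩
    · intro i hi j hj hij
      simp only [Set.mem_Iio] at hi hj
      by_contra hne
      by_cases hi' : i = m + 3 <;> by_cases hj' : j = m + 3
      · omega
      · rw [hi', Function.update_self, Function.update_of_ne hj'] at hij
        exact hv j (by omega) hij
      · rw [hj', Function.update_self, Function.update_of_ne hi'] at hij
        exact hv i (by omega) hij.symm
      · rw [Function.update_of_ne hi', Function.update_of_ne hj'] at hij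
        exact hne (hp (Set.mem_Iio.2 (by omega)) (Set.mem_Iio.2 (by omega)) hij)
    · intro i hi
      rw [Function.update_of_ne (by omega)]
      by_cases hi' : i = m + 2
      · subst hi'
        rw [h1, Function.update_self]
      · rw [Function.update_of_ne (by omega), hxp i (by omega)]

theorem exists_chain {m : ℕ} (hm : 2 ≤ m) (hm3 : m ≠ 3) {x : ℕ → Perm X} (hx : BraidSeq m x)
    (hs : ∀ i < m, (x i).IsSwap) (hne : x 0 ≠ x 1) :
    ∃ p : ℕ → X, Set.InjOn p (Set.Iio (m + 1)) ∧ ∀ i < m, x i = swap (p i) (p (i + 1)) := by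
  obtain ⟨m, rfl⟩ := Nat.exists_eq_add_of_le' hm
  exact exists_chain_aux hx hs fun i j hij hj h => hne (hx.zero_eq_one_of_eq hm3 hij hj h)

end BraidSeq

/-! ### Centralizers in the symmetric groups on five and six letters -/

open Equiv

theorem eq_of_braid_of_card_eq_pow {G : Type*} [Group G] {p k : ℕ} (hp : p.Prime)
    (hG : Nat.card G = p ^ k) {a b : G} (h : a * b * a = b * a * b) : a = b := by
  have := Fact.mk hp
  have : Finite G := Nat.finite_of_card_ne_zero (by rw [hG]; exact pow_ne_zero _ hp.ne_zero)
  have := (IsPGroup.of_card hG).isNilpotent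
  exact eq_of_braid_of_isNilpotent G a b h

/-- A subgroup of order `3 ^ k` has index two, so it contains all squares, in particular every `c =
(c ^ 2) ^ 2` with `c ^ 3 = 1`. The relation thus lives in a 3-group. -/
theorem eq_of_braid_of_card_eq_two_mul_three_pow {G : Type*} [Group G] {k : ℕ}
    (hG : Nat.card G = 2 * 3 ^ k) {a b : G} (h : a * b * a = b * a * b) (ha : a ^ 3 = 1)
    (hb : b ^ 3 = 1) : a = b := by
  have := Fact.mk Nat.prime_three
  have : Finite G := Nat.finite_of_card_ne_zero (by rw [hG]; positivity)
  obtain ⟨P, hP⟩ := Sylow.exists_subgroup_card_pow_prime (G := G) 3 (n := k)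
    (by rw [hG]; exact dvd_mul_left _ _)
  have hidx : P.index = 2 := by
    have := P.card_mul_index
    rw [hP, hG, mul_comm] at this
    exact Nat.eq_of_mul_eq_mul_right (by positivity) this
  have := Subgroup.normal_of_index_eq_two hidx
  have hmem : ∀ c : G, c ^ 3 = 1 → c ∈ P := fun c hc => by
    have := P.mul_mem (Subgroup.sq_mem_of_index_two hidx (c ^ 2)) (P.one_mem)
    rw [mul_one, ← pow_mul, show 2 * 2 = 3 + 1 by rfl, pow_succ, hc, one_mul] at this
    exact this
  have := eq_of_braid_of_card_eq_pow Nat.prime_three hP (a := ⟨a, hmem a ha⟩)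
    (b := ⟨b, hmem b hb⟩) (Subtype.ext h)
  exact congrArg Subtype.val this

theorem eq_of_braid_of_card_eq_orderOf {G : Type*} [Group G] [Finite G] {c : G}
    (hG : Nat.card (Subgroup.centralizer {c}) = orderOf c) {a b : Subgroup.centralizer {c}}
    (h : a * b * a = b * a * b) : a = b := by
  have hle : Subgroup.zpowers c ≤ Subgroup.centralizer {c} := by
    rw [Subgroup.zpowers_le, Subgroup.mem_centralizer_singleton_iff]
  have heq := Subgroup.eq_of_le_of_card_ge hle (by rw [hG, Nat.card_zpowers])
  refine eq_of_braid_of_commute h (Subtype.ext ?_)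
  obtain ⟨i, hi⟩ := Subgroup.mem_zpowers_iff.1 (heq.ge a.2)
  obtain ⟨j, hj⟩ := Subgroup.mem_zpowers_iff.1 (heq.ge b.2)
  rw [Subgroup.coe_mul, Subgroup.coe_mul, ← hi, ← hj]
  exact (Commute.refl c).zpow_zpow i j

theorem Multiset.mem_of_two_le_of_sum_le_six {s : Multiset ℕ} (h2 : ∀ a ∈ s, 2 ≤ a)
    (hs : s.sum ≤ 6) :
    s ∈ ([0, {2}, {3}, {4}, {5}, {6}, {2, 2}, {3, 2}, {4, 2}, {3, 3}, {2, 2, 2}] :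
      List (Multiset ℕ)) := by
  induction s using Multiset.induction with
  | empty => decide
  | cons a s _ =>
  induction s using Multiset.induction with
  | empty =>
    simp only [Multiset.mem_cons, forall_eq_or_imp, Multiset.sum_cons, Multiset.sum_zero,
      add_zero] at h2 hs
    obtain ⟨ha, -⟩ := h2
    interval_cases a <;> first | omega | decide
  | cons b s _ =>
  induction s using Multiset.induction with
  | empty =>
    simp only [Multiset.mem_cons, forall_eq_or_imp, Multiset.sum_cons, Multiset.sum_zero,
      add_zero] at h2 hs
    obtain ⟨ha, hb, -⟩ := h2
    have : a ≤ 4 := by omega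
    have : b ≤ 4 := by omega
    interval_cases a <;> interval_cases b <;> first | omega | decide
  | cons c s _ =>
  induction s using Multiset.induction with
  | empty =>
    simp only [Multiset.mem_cons, forall_eq_or_imp, Multiset.sum_cons, Multiset.sum_zero,
      add_zero] at h2 hs
    obtain ⟨ha, hb, hc, -⟩ := h2
    obtain ⟨rfl, rfl, rfl⟩ : a = 2 ∧ b = 2 ∧ c = 2 := by omega
    decide
  | cons d s _ =>
    simp only [Multiset.mem_cons, forall_eq_or_imp, Multiset.sum_cons] at h2 hs
    omega

namespace Equiv.Perm

/-- Outside the two excluded cycle types and the identity, the centralizer of `a` is a 2-group, or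
is generated by `a`, or has order `2 * 3 ^ k` with `a` of order three. Being conjugate to `a` is
what puts `b` and `c` into the 3-part in the last case. -/
theorem eq_of_braid_of_commute_of_card_le_six {n : ℕ} (hn : n = 5 ∨ n = 6) {a b c : Perm (Fin n)}
    (hb : IsConj a b) (hc : IsConj a c) (hab : Commute a b) (hac : Commute a c)
    (h : b * c * b = c * b * c) (h2 : a.cycleType ≠ {2}) (h222 : a.cycleType ≠ {2, 2, 2}) :
    b = c := by
  have hcard := nat_card_centralizer a
  have hs := sum_cycleType_le a
  have hord := lcm_cycleType a
  have hmem := Multiset.mem_of_two_le_of_sum_le_six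
    (fun _ => two_le_of_mem_cycleType) (hs.trans (by rw [Fintype.card_fin]; omega))
  obtain ⟨b, rfl⟩ : ∃ b' : Subgroup.centralizer {a}, (b' : Perm (Fin n)) = b :=
    ⟨⟨b, Subgroup.mem_centralizer_singleton_iff.2 hab.eq.symm⟩, rfl⟩
  obtain ⟨c, rfl⟩ : ∃ c' : Subgroup.centralizer {a}, (c' : Perm (Fin n)) = c :=
    ⟨⟨c, Subgroup.mem_centralizer_singleton_iff.2 hac.eq.symm⟩, rfl⟩
  replace h : b * c * b = c * b * c := Subtype.ext h
  congr 1
  have hbo : ∀ k, a ^ k = 1 → b ^ k = 1 := fun k hk => by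
    obtain ⟨g, hg⟩ := isConj_iff.1 hb
    refine Subtype.ext ?_
    rw [Subgroup.coe_pow, ← hg, conj_pow, hk, mul_one, mul_inv_cancel, Subgroup.coe_one]
  have hco : ∀ k, a ^ k = 1 → c ^ k = 1 := fun k hk => by
    obtain ⟨g, hg⟩ := isConj_iff.1 hc
    refine Subtype.ext ?_
    rw [Subgroup.coe_pow, ← hg, conj_pow, hk, mul_one, mul_inv_cancel, Subgroup.coe_one]
  have p0 : orderOf a = 1 → b = c := fun ha => by
    have ha : a ^ 1 = 1 := ha ▸ pow_orderOf_eq_one a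
    rw [← pow_one b, ← pow_one c, hbo 1 ha, hco 1 ha]
  have p2 : ∀ k, Nat.card (Subgroup.centralizer {a}) = 2 ^ k → b = c := fun k hk =>
    eq_of_braid_of_card_eq_pow Nat.prime_two hk h
  have p3 : ∀ k, orderOf a = 3 → Nat.card (Subgroup.centralizer {a}) = 2 * 3 ^ k → b = c :=
    fun k ha hk => eq_of_braid_of_card_eq_two_mul_three_pow hk h
      (hbo 3 (ha ▸ pow_orderOf_eq_one a)) (hco 3 (ha ▸ pow_orderOf_eq_one a))
  have p5 : ∀ k, orderOf a = k → Nat.card (Subgroup.centralizer {a}) = k → b = c :=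
    fun k ha hk => eq_of_braid_of_card_eq_orderOf (hk.trans ha.symm) h
  generalize a.cycleType = s at *
  simp only [List.mem_cons, List.not_mem_nil, or_false] at hmem
  rw [Fintype.card_fin] at hs
  rcases hn with rfl | rfl
  · rcases hmem with rfl | rfl | rfl | rfl | rfl | rfl | rfl | rfl | rfl | rfl | rfl
    · exact p0 (hord.symm.trans (by decide))
    · contradiction
    · exact p3 1 (hord.symm.trans (by decide)) (hcard.trans (by decide))
    · exact p2 2 (hcard.trans (by decide))
    · exact p5 5 (hord.symm.trans (by decide)) (hcard.trans (by decide))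
    · exact absurd hs (by decide)
    · exact p2 3 (hcard.trans (by decide))
    · exact p5 6 (hord.symm.trans (by decide)) (hcard.trans (by decide))
    · exact absurd hs (by decide)
    · exact absurd hs (by decide)
    · exact absurd hs (by decide)
  · rcases hmem with rfl | rfl | rfl | rfl | rfl | rfl | rfl | rfl | rfl | rfl | rfl
    · exact p0 (hord.symm.trans (by decide))
    · contradiction
    · exact p3 2 (hord.symm.trans (by decide)) (hcard.trans (by decide))
    · exact p2 3 (hcard.trans (by decide))
    · exact p5 5 (hord.symm.trans (by decide)) (hcard.trans (by decide))
    · exact p5 6 (hord.symm.trans (by decide)) (hcard.trans (by decide))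
    · exact p2 4 (hcard.trans (by decide))
    · exact p5 6 (hord.symm.trans (by decide)) (hcard.trans (by decide))
    · exact p2 3 (hcard.trans (by decide))
    · exact p3 2 (hord.symm.trans (by decide)) (hcard.trans (by decide))
    · contradiction

end Equiv.Perm

/-! ### Actions of a centralizer on cycles and on fixed points -/

namespace Equiv.Perm

/-- The restriction of the centralizer of `a` to the fixed points of `a`. -/
def centralizerToPermFixed {X : Type*} (a : Perm X) :
    Subgroup.centralizer {a} →* Perm {p : X // a p = p} where
  toFun g := (g : Perm X).subtypePerm fun p => by
    have := DFunLike.congr_fun (Subgroup.mem_centralizer_singleton_iff.1 g.2) p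
    simp only [mul_apply] at this
    rw [← this, EmbeddingLike.apply_eq_iff_eq]
  map_one' := rfl
  map_mul' _ _ := rfl

/-- Two permutations commuting with a cycle commute with each other on its support. -/
theorem IsCycle.apply_apply_comm_of_commute {X : Type*} {c g h : Perm X} (hc : c.IsCycle) (hg : Commute g c)
    (hh : Commute h c) {p : X} (hp : c p ≠ p) : g (h p) = h (g p) := by
  have hmem : ∀ {g : Perm X}, Commute g c → c (g p) ≠ g p := fun {g} hg h => hp (by
    have := DFunLike.congr_fun hg.eq p
    simp only [mul_apply, h] at this
    exact g.injective this)
  obtain ⟨i, hi⟩ := hc.sameCycle hp (hmem hg)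
  obtain ⟨j, hj⟩ := hc.sameCycle hp (hmem hh)
  have hgj := DFunLike.congr_fun (hg.zpow_right j).eq p
  have hhi := DFunLike.congr_fun (hh.zpow_right i).eq p
  simp only [mul_apply] at hgj hhi
  -- At `p`, each of `g` and `h` acts as a power of `c`, and powers of `c` commute.
  rw [← hj, hgj, ← hi, hhi, ← hj, ← mul_apply, ← mul_apply, ← zpow_add, ← zpow_add, add_comm]

variable {X : Type*} [Fintype X] [DecidableEq X]

theorem apply_apply_comm_of_mem_ker_toPermHom {a : Perm X} {g h : Subgroup.centralizer {a}}
    (hg : OnCycleFactors.toPermHom a g = 1) (hh : OnCycleFactors.toPermHom a h = 1) {p : X}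
    (hp : a p ≠ p) : (g : Perm X) ((h : Perm X) p) = (h : Perm X) ((g : Perm X) p) := by
  have hc : a.cycleOf p ∈ a.cycleFactorsFinset :=
    cycleOf_mem_cycleFactorsFinset_iff.2 (mem_support.2 hp)
  refine (isCycle_cycleOf a hp).apply_apply_comm_of_commute
    ((OnCycleFactors.mem_ker_toPermHom_iff _ _).1 hg _ hc)
    ((OnCycleFactors.mem_ker_toPermHom_iff _ _).1 hh _ hc) ?_
  rwa [cycleOf_apply_self]

theorem two_mul_card_cycleFactorsFinset_le (a : Perm X) :
    2 * a.cycleFactorsFinset.card ≤ Fintype.card X := by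
  have h := Multiset.card_nsmul_le_sum (s := a.cycleType) (a := 2)
    (fun _ => two_le_of_mem_cycleType)
  have h1 : Multiset.card a.cycleType = a.cycleFactorsFinset.card := by
    rw [cycleType_def, Multiset.card_map]; rfl
  rw [h1, smul_eq_mul] at h
  have := a.sum_cycleType_le
  omega

end Equiv.Perm

/-! ### Induction on the number of generators -/

namespace BraidSeq

open Equiv.Perm

/-- A braid sequence in the centralizer of `a` whose action on the cycles of `a` is constant
is constant on the support of `a`. -/
theorem apply_eq_of_toPermHom_eq {X : Type*} [Fintype X] [DecidableEq X] {m : ℕ} (hm : 4 ≤ m)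
    {a : Perm X} {z : ℕ → Subgroup.centralizer {a}} (hz : BraidSeq m z)
    (h : OnCycleFactors.toPermHom a (z 0) = OnCycleFactors.toPermHom a (z 1)) {p : X}
    (hp : a p ≠ p) : (z 0 : Perm X) p = (z 1 : Perm X) p := by
  have hmem : ∀ (g : Subgroup.centralizer {a}) {q : X}, a q ≠ q →
      a ((g : Perm X) q) ≠ (g : Perm X) q := fun g q hq hgq => hq (by
    have := DFunLike.congr_fun (Subgroup.mem_centralizer_singleton_iff.1 g.2) q
    simp only [mul_apply, hgq] at this
    exact g.1.injective this)
  have h3 : OnCycleFactors.toPermHom a (z 3) = OnCycleFactors.toPermHom a (z 0) :=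
    (hz.map _).eq_zero h (i := 3) (by omega)
  have hu : OnCycleFactors.toPermHom a (z 0 * (z 3)⁻¹) = 1 := by
    rw [map_mul, map_inv, h3, mul_inv_cancel]
  have hv : OnCycleFactors.toPermHom a (z 1 * (z 3)⁻¹) = 1 := by
    rw [map_mul, map_inv, h3, ← h, mul_inv_cancel]
  have hcomm : ∀ q : X, a q ≠ q →
      (z 0 : Perm X) ((z 1 : Perm X) q) = (z 1 : Perm X) ((z 0 : Perm X) q) := by
    intro q hq
    -- The quotients by `z 3` preserve every cycle, so they commute on the support. Evaluating at `z
    -- 3 * z 3` applied to `q` cancels the inverses, as `z 3` commutes with `z 0` and `z 1`.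
    have key := apply_apply_comm_of_mem_ker_toPermHom hu hv (hmem (z 3 * z 3) hq)
    have h0 : z 0 * (z 3)⁻¹ * (z 1 * (z 3)⁻¹ * (z 3 * z 3)) = z 0 * z 1 := by
      have := (hz.comm 1 3 (by omega) (by omega)).eq
      calc _ = z 0 * (z 3)⁻¹ * (z 1 * z 3) := by group
        _ = _ := by rw [this]; group
    have h1 : z 1 * (z 3)⁻¹ * (z 0 * (z 3)⁻¹ * (z 3 * z 3)) = z 1 * z 0 := by
      have := (hz.comm 0 3 (by omega) (by omega)).eq
      calc _ = z 1 * (z 3)⁻¹ * (z 0 * z 3) := by group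
        _ = _ := by rw [this]; group
    simp only [← mul_apply, ← Subgroup.coe_mul] at key ⊢
    rwa [h0, h1] at key
  have hb := DFunLike.congr_fun (congrArg Subtype.val (hz.braid 0 (by omega))) p
  have hc := hcomm _ (hmem (z 0) hp)
  simp only [Subgroup.coe_mul, mul_apply, zero_add] at hb
  rw [hb] at hc
  exact ((z 0).1.injective ((z 1).1.injective (by rw [hc]))).symm

theorem cycleType_zero_of_le {m : ℕ} (hm : 4 ≤ m) {X : Type} [Fintype X] [DecidableEq X]
    (hX : Fintype.card X ≤ m + 1) {x : ℕ → Perm X} (hx : BraidSeq m x) (hne : x 0 ≠ x 1)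
    (hm' : m = 4 ∨ m = 5) :
    (x 0).cycleType = {2} ∨ (m = 5 ∧ (x 0).cycleType = {2, 2, 2}) := by
  -- Extending by fixed points preserves cycle types, so only the groups on exactly five or six
  -- letters need inspection.
  obtain ⟨e⟩ : Nonempty (X ↪ Fin (m + 1)) :=
    Function.Embedding.nonempty_of_card_le (by simpa using hX)
  have hct : ∀ g : Perm X, (viaEmbeddingHom e g).cycleType = g.cycleType := fun g => by
    rw [viaEmbeddingHom_apply, viaEmbedding]
    convert cycleType_extendDomain _
  have hy := hx.map (viaEmbeddingHom e)
  by_contra! hcon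
  have h23 : x 2 = x 3 := viaEmbeddingHom_injective e
    (eq_of_braid_of_commute_of_card_le_six (by omega) (hy.isConj (i := 2) (by omega))
      (hy.isConj (i := 3) (by omega)) (hy.comm 0 2 (by omega) (by omega))
      (hy.comm 0 3 (by omega) (by omega)) (hy.braid 2 (by omega)) (by rw [hct]; exact hcon.1)
      (by
        rw [hct]
        obtain rfl | rfl := hm'
        · intro h
          have := (x 0).sum_cycleType_le
          rw [h] at this
          have := this.trans hX
          revert this
          decide
        · exact hcon.2 rfl))
  exact hne ((hx.succ_eq_iff_zero_eq_one (i := 2) (by omega)).1 h23)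

/-- There is no room: a chain of `m` transpositions uses `m + 1` letters, and three disjoint
transpositions use six while `m = 5`. -/
theorem zero_eq_one_of_cycleType {m : ℕ} (hm : 4 ≤ m) {X : Type} [Fintype X] [DecidableEq X]
    (hX : Fintype.card X ≤ m) {x : ℕ → Perm X} (hx : BraidSeq m x)
    (h : x 0 ≠ x 1 → (x 0).cycleType = {2} ∨ (m = 5 ∧ (x 0).cycleType = {2, 2, 2})) :
    x 0 = x 1 := by
  by_contra hne
  obtain h2 | ⟨rfl, h2⟩ := h hne
  · obtain ⟨p, hp, -⟩ := hx.exists_chain (by omega) (by omega) (fun i hi =>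
      isSwap_iff_cycleType.2 ((isConj_iff_cycleType_eq.1 (hx.isConj hi)).symm.trans h2)) hne
    have := Fintype.card_le_of_injective (fun i : Fin (m + 1) => p i) fun i j hij =>
      Fin.ext (hp i.2 j.2 hij)
    rw [Fintype.card_fin] at this
    omega
  · have := (x 0).sum_cycleType_le
    rw [h2] at this
    have := this.trans hX
    revert this
    decide

/-- The set of letters is quantified inside the induction because the hypothesis is applied to two
other sets: the cycles of `x 0` and its fixed points. -/
theorem cycleType_zero {m : ℕ} (hm : 4 ≤ m) : ∀ {X : Type} [Fintype X] [DecidableEq X],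
    Fintype.card X ≤ m + 1 → ∀ {x : ℕ → Perm X}, BraidSeq m x → x 0 ≠ x 1 →
    (x 0).cycleType = {2} ∨ (m = 5 ∧ (x 0).cycleType = {2, 2, 2}) := by
  induction m using Nat.strong_induction_on with
  | _ m ih =>
  intro X _ _ hX x hx hne
  by_cases hm' : m = 4 ∨ m = 5
  · exact cycleType_zero_of_le hm hX hx hne hm'
  obtain ⟨k, rfl⟩ : ∃ k, m = k + 2 := ⟨m - 2, by omega⟩
  have rigid : ∀ {Y : Type} [Fintype Y] [DecidableEq Y], Fintype.card Y ≤ k →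
      ∀ {y : ℕ → Perm Y}, BraidSeq k y → y 0 = y 1 := fun hY y hy =>
    hy.zero_eq_one_of_cycleType (by omega) hY (ih k (by omega) (by omega) (by omega) hy)
  obtain ⟨z, hz, hzx⟩ := hx.shift.exists_lift (Subgroup.centralizer {x 0}) fun i hi =>
    Subgroup.mem_centralizer_singleton_iff.2 (hx.comm 0 (i + 2) (by omega) (by omega)).eq.symm
  -- There are at most `(k + 3) / 2 ≤ k` cycles, few enough for rigidity.
  have hcyc : OnCycleFactors.toPermHom (x 0) (z 0) = OnCycleFactors.toPermHom (x 0) (z 1) := by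
    refine rigid ?_ (hz.map (OnCycleFactors.toPermHom (x 0)))
    have := two_mul_card_cycleFactorsFinset_le (x 0)
    rw [Fintype.card_coe]
    omega
  -- With at most `k` fixed points, `z 0` and `z 1` would agree there by rigidity and on the support
  -- by the action on cycles, forcing `x 2 = x 3`.
  have hfix : k < Fintype.card {p : X // x 0 p = p} := by
    by_contra! hle
    have hF := rigid hle (hz.map (centralizerToPermFixed (x 0)))
    have h01 : (z 0 : Perm X) = z 1 := by
      ext p
      by_cases hp : x 0 p = p
      · exact congrArg Subtype.val (DFunLike.congr_fun hF ⟨p, hp⟩)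
      · exact hz.apply_eq_of_toPermHom_eq (by omega) hcyc hp
    rw [hzx 0 (by omega), hzx 1 (by omega)] at h01
    exact hne ((hx.succ_eq_iff_zero_eq_one (i := 2) (by omega)).1 h01)
  have hsupp : (x 0).support.card ≤ 2 := by
    have h1 := Fintype.card_subtype_compl (fun p => x 0 p = p)
    have h2 : Fintype.card {p : X // ¬ x 0 p = p} = (x 0).support.card := by
      rw [Fintype.card_subtype]; rfl
    omega
  left
  have h1 : x 0 ≠ 1 := fun h => hne (by
    have := hx.isConj (i := 1) (by omega)
    rw [h, isConj_one_right] at this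
    rw [h, this])
  rw [← isSwap_iff_cycleType, ← card_support_eq_two]
  have := two_le_card_support_of_ne_one h1
  omega

theorem zero_eq_one_of_card_le {m : ℕ} (hm : 4 ≤ m) {X : Type} [Fintype X] [DecidableEq X]
    (hX : Fintype.card X ≤ m) {x : ℕ → Perm X} (hx : BraidSeq m x) : x 0 = x 1 :=
  hx.zero_eq_one_of_cycleType hm hX (cycleType_zero hm (by omega) hx)

end BraidSeq

/-! ### The outer automorphism of the symmetric group on six letters -/

theorem closure_swap_rotate_six :
    Subgroup.closure {(c[0, 1] : Perm (Fin 6)), c[0, 1, 2, 3, 4, 5]} = ⊤ := by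
  have h := Perm.closure_cycle_adjacent_swap (σ := (c[0, 1, 2, 3, 4, 5] : Perm (Fin 6)))
    (Cycle.isCycle_formPerm _ _ ⟨0, 1, by decide, by decide, by decide⟩) (by decide) 0
  rw [Set.pair_comm]
  rwa [show (c[0, 1] : Perm (Fin 6)) = swap 0 ((c[0, 1, 2, 3, 4, 5] : Perm (Fin 6)) 0) by decide]

theorem MonoidHom.eq_of_eq_on_swap_rotate_six {H : Type*} [Group H] {f g : Perm (Fin 6) →* H}
    (hs : f c[0, 1] = g c[0, 1]) (hr : f c[0, 1, 2, 3, 4, 5] = g c[0, 1, 2, 3, 4, 5]) : f = g := by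
  refine MonoidHom.eq_of_eqOn_dense closure_swap_rotate_six ?_
  rintro _ (rfl | rfl)
  exacts [hs, hr]

/-- A family of points permuted by a generating set gives a homomorphism to the symmetric group
of the index set. -/
theorem exists_monoidHom_of_smul_mem_range {G β ι : Type*} [Group G] [MulAction G β] {T : ι → β}
    (hT : Function.Injective T) {S : Set G} (hS : Subgroup.closure S = ⊤)
    (h : ∀ g ∈ S, ∃ τ : Perm ι, ∀ i, g • T i = T (τ i)) :
    ∃ f : G →* Perm ι, ∀ g i, g • T i = T (f g i) := by
  have hall : ∀ g : G, ∃ τ : Perm ι, ∀ i, g • T i = T (τ i) := by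
    intro g
    have hg : g ∈ Subgroup.closure S := hS ▸ Subgroup.mem_top g
    induction hg using Subgroup.closure_induction with
    | mem x hx => exact h x hx
    | one => exact ⟨1, fun i => by rw [one_smul]; rfl⟩
    | mul x y _ _ hx hy =>
      obtain ⟨σ, hσ⟩ := hx
      obtain ⟨τ, hτ⟩ := hy
      exact ⟨σ * τ, fun i => by rw [mul_smul, hτ, hσ]; rfl⟩
    | inv x _ hx =>
      obtain ⟨σ, hσ⟩ := hx
      exact ⟨σ⁻¹, fun i => by rw [inv_smul_eq_iff, hσ]; simp⟩
  -- Injectivity of `T` determines each chosen permutation, which makes the choice multiplicative.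
  choose f hf using hall
  refine ⟨⟨⟨f, ?_⟩, ?_⟩, hf⟩
  · ext i
    refine hT ?_
    rw [← hf, one_smul]; rfl
  · intro g k
    ext i
    refine hT ?_
    rw [← hf, mul_smul, hf, hf]; rfl

/-- A one-factorization of the complete graph on six letters, each one-factor being given as a
fixed-point free involution. -/
def baseTotal : Finset (Perm (Fin 6)) :=
  {swap 0 1 * swap 2 5 * swap 3 4, swap 0 2 * swap 1 3 * swap 4 5, swap 0 3 * swap 1 5 * swap 2 4,
    swap 0 4 * swap 1 2 * swap 3 5, swap 0 5 * swap 1 4 * swap 2 3}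

/-- Conjugators taking `baseTotal` to each of the six one-factorizations. -/
def totalConj : Fin 6 → Perm (Fin 6) :=
  let t : Perm (Fin 6) := c[0, 1]
  let r : Perm (Fin 6) := c[0, 1, 2, 3, 4, 5]
  -- The labelling is dictated by the desired images of the generators: `r` must carry label 0 to 1
  -- to 2 and 3 to 4, while `t` must carry 2 to 3 and 4 to 5.
  ![1, r, r ^ 2, t * r ^ 2, r * (t * r ^ 2), t * (r * (t * r ^ 2))]

/-- The image of a finite set of permutations under conjugation. -/
def conjFinset (g : Perm (Fin 6)) (A : Finset (Perm (Fin 6))) : Finset (Perm (Fin 6)) :=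
  A.image fun x => g * x * g⁻¹

/-- The action of `S_6` on its finite subsets by conjugation. -/
abbrev conjFinsetAction : MulAction (Perm (Fin 6)) (Finset (Perm (Fin 6))) where
  smul := conjFinset
  one_smul A := by
    change A.image _ = A
    simp
  mul_smul g h A := by
    change A.image _ = (A.image _).image _
    rw [Finset.image_image]
    refine congrArg (A.image ·) (funext fun x => ?_)
    simp [mul_assoc]

/-- The six one-factorizations of the complete graph on six letters. -/
def total (i : Fin 6) : Finset (Perm (Fin 6)) := conjFinset (totalConj i) baseTotal

theorem swap_smul_total (i : Fin 6) :
    conjFinset c[0, 1] (total i) = total ((c[0, 1] * c[2, 3] * c[4, 5] : Perm (Fin 6)) i) := by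
  revert i; decide +kernel

theorem rotate_smul_total (i : Fin 6) :
    conjFinset c[0, 1, 2, 3, 4, 5] (total i) = total ((c[0, 1, 2] * c[3, 4] : Perm (Fin 6)) i) := by
  revert i; decide +kernel

theorem total_injective : Function.Injective total := by
  unfold Function.Injective
  decide +kernel

theorem exists_hom_six : ∃ f : Perm (Fin 6) →* Perm (Fin 6),
    f c[0, 1] = c[0, 1] * c[2, 3] * c[4, 5] ∧ f c[0, 1, 2, 3, 4, 5] = c[0, 1, 2] * c[3, 4] := by
  let := conjFinsetAction
  obtain ⟨f, hf⟩ := exists_monoidHom_of_smul_mem_range total_injective closure_swap_rotate_six (by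
    rintro _ (rfl | rfl)
    exacts [⟨_, swap_smul_total⟩, ⟨_, rotate_smul_total⟩])
  refine ⟨f, ?_, ?_⟩
  · ext1 i
    exact total_injective ((hf _ i).symm.trans (swap_smul_total i))
  · ext1 i
    exact total_injective ((hf _ i).symm.trans (rotate_smul_total i))

/-- This yields bijectivity of `f` without computing its kernel: its square is inner, hence
injective. The conjugator is verified on the two generators, after writing their images as products
of adjacent transpositions. -/
theorem hom_six_comp_self {f : Perm (Fin 6) →* Perm (Fin 6)}
    (hs : f c[0, 1] = c[0, 1] * c[2, 3] * c[4, 5])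
    (hr : f c[0, 1, 2, 3, 4, 5] = c[0, 1, 2] * c[3, 4]) :
    f.comp f = (MulAut.conj (c[0, 5, 1, 4, 2] : Perm (Fin 6))).toMonoidHom := by
  have key : ∀ k : ℕ, f (c[0, 1, 2, 3, 4, 5] ^ k * c[0, 1] * (c[0, 1, 2, 3, 4, 5] ^ k)⁻¹) =
      (c[0, 1, 2] * c[3, 4]) ^ k * (c[0, 1] * c[2, 3] * c[4, 5]) *
        ((c[0, 1, 2] * c[3, 4]) ^ k)⁻¹ := fun k => by
    rw [map_mul, map_mul, map_inv, map_pow, hs, hr]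
  have h1 := key 1
  have h2 := key 2
  have h3 := key 3
  have h4 := key 4
  rw [show (c[0, 1, 2, 3, 4, 5] ^ 1 * c[0, 1] * (c[0, 1, 2, 3, 4, 5] ^ 1)⁻¹ : Perm (Fin 6)) =
    c[1, 2] by decide +kernel] at h1
  rw [show (c[0, 1, 2, 3, 4, 5] ^ 2 * c[0, 1] * (c[0, 1, 2, 3, 4, 5] ^ 2)⁻¹ : Perm (Fin 6)) =
    c[2, 3] by decide +kernel] at h2
  rw [show (c[0, 1, 2, 3, 4, 5] ^ 3 * c[0, 1] * (c[0, 1, 2, 3, 4, 5] ^ 3)⁻¹ : Perm (Fin 6)) =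
    c[3, 4] by decide +kernel] at h3
  rw [show (c[0, 1, 2, 3, 4, 5] ^ 4 * c[0, 1] * (c[0, 1, 2, 3, 4, 5] ^ 4)⁻¹ : Perm (Fin 6)) =
    c[4, 5] by decide +kernel] at h4
  refine MonoidHom.eq_of_eq_on_swap_rotate_six ?_ ?_
  · rw [MonoidHom.comp_apply, hs, map_mul, map_mul, hs, h2, h4]
    decide +kernel
  · rw [MonoidHom.comp_apply, hr, map_mul,
      show (c[0, 1, 2] : Perm (Fin 6)) = c[0, 1] * c[1, 2] by decide +kernel, map_mul, hs, h1, h3]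
    decide +kernel

theorem exists_mulAut_six : ∃ α : MulAut (Perm (Fin 6)),
    α c[0, 1] = c[0, 1] * c[2, 3] * c[4, 5] ∧ α c[0, 1, 2, 3, 4, 5] = c[0, 1, 2] * c[3, 4] := by
  obtain ⟨f, hs, hr⟩ := exists_hom_six
  have hinj : Function.Injective f := by
    refine Function.Injective.of_comp (f := f) ?_
    rw [← MonoidHom.coe_comp, hom_six_comp_self hs hr]
    exact (MulAut.conj _).injective
  exact ⟨MulEquiv.ofBijective f (Finite.injective_iff_bijective.1 hinj), hs, hr⟩

/-! ### Homomorphisms from the braid group -/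

section

variable {G : Type*} [Group G] {n : ℕ}

/-- The images of the standard generators under a homomorphism, continued by `1`. -/
def braidImage (f : BraidGroup n →* G) (i : ℕ) : G :=
  if h : i < n - 1 then f (PresentedGroup.of ⟨i, h⟩) else 1

theorem braidImage_of_lt (f : BraidGroup n →* G) {i : ℕ} (h : i < n - 1) :
    braidImage f i = f (PresentedGroup.of ⟨i, h⟩) :=
  dif_pos h

theorem braidSeq_braidImage (f : BraidGroup n →* G) : BraidSeq (n - 1) (braidImage f) where
  braid i hi := by
    have h : PresentedGroup.mk (braidRels n) _ = 1 := PresentedGroup.one_of_mem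
      (Or.inl ⟨⟨i, by omega⟩, ⟨i + 1, hi⟩, rfl, rfl⟩)
    simp only [map_mul, map_inv, mul_inv_eq_one] at h
    have := congrArg f h
    simp only [map_mul] at this
    rw [braidImage_of_lt f hi, braidImage_of_lt f (by omega)]
    exact this
  comm i j hij hj := by
    have h : PresentedGroup.mk (braidRels n) _ = 1 := PresentedGroup.one_of_mem
      (Or.inr ⟨⟨i, by omega⟩, ⟨j, hj⟩, Or.inl hij, rfl⟩)
    simp only [map_mul, map_inv, mul_inv_eq_one] at h
    have := congrArg f h
    simp only [map_mul] at this
    rw [braidImage_of_lt f hj, braidImage_of_lt f (by omega)]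
    exact this

/-- A cyclic image is abelian, so the first two generators have equal images; conversely that
equality makes all generators have the same image. -/
theorem cyclicHom_iff (hn : 3 ≤ n) (f : BraidGroup n →* G) :
    CyclicHom f ↔ braidImage f 0 = braidImage f 1 := by
  have hx := braidSeq_braidImage f
  constructor
  · intro hf
    refine eq_of_braid_of_commute (hx.braid 0 (by omega)) ?_
    rw [braidImage_of_lt f (i := 0) (by omega), braidImage_of_lt f (i := 1) (by omega)]
    obtain ⟨g, hg⟩ := hf.exists_generator
    obtain ⟨k, hk⟩ := Subgroup.mem_zpowers_iff.1 (hg ⟨_, _, rfl⟩)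
    obtain ⟨l, hl⟩ := Subgroup.mem_zpowers_iff.1 (hg ⟨_, _, rfl⟩)
    have h := congrArg Subtype.val (((Commute.refl g).zpow_zpow k l).eq)
    rw [hk, hl] at h
    exact h
  · intro h
    have hle : f.range ≤ Subgroup.zpowers (braidImage f 0) := by
      rw [MonoidHom.range_eq_map, ← PresentedGroup.closure_range_of, MonoidHom.map_closure,
        Subgroup.closure_le]
      rintro _ ⟨_, ⟨i, rfl⟩, rfl⟩
      have := hx.eq_zero h i.2
      rw [braidImage_of_lt f i.2] at this
      exact this ▸ Subgroup.mem_zpowers _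
    exact isCyclic_of_injective (Subgroup.inclusion hle) (Subgroup.inclusion_injective hle)

theorem not_cyclicHom_comp_iff {H : Type*} [Group H] (hn : 3 ≤ n) (f : BraidGroup n →* G)
    {g : G →* H} (hg : Function.Injective g) : ¬ CyclicHom (g.comp f) ↔ ¬ CyclicHom f := by
  rw [cyclicHom_iff hn, cyclicHom_iff hn, braidImage_of_lt _ (i := 0) (by omega),
    braidImage_of_lt _ (i := 1) (by omega), braidImage_of_lt _ (i := 0) (by omega),
    braidImage_of_lt _ (i := 1) (by omega)]
  exact hg.eq_iff.not

theorem ConjHom.not_cyclicHom (hn : 3 ≤ n) {f g : BraidGroup n →* G} (h : ConjHom f g)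
    (hg : ¬ CyclicHom g) : ¬ CyclicHom f := by
  obtain ⟨s, hs⟩ := h
  have : f = (MulAut.conj s).toMonoidHom.comp g := MonoidHom.ext hs
  rw [this]
  exact (not_cyclicHom_comp_iff hn g (MulAut.conj s).injective).2 hg

end

theorem braidProj_of {n : ℕ} (i : Fin (n - 1)) :
    braidProj n (PresentedGroup.of i) = adjSwap n i :=
  PresentedGroup.toGroup.of _

theorem not_cyclicHom_braidProj {n : ℕ} (hn : 3 ≤ n) : ¬ CyclicHom (braidProj n) := by
  rw [cyclicHom_iff hn, braidImage_of_lt _ (i := 0) (by omega),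
    braidImage_of_lt _ (i := 1) (by omega), braidProj_of, braidProj_of]
  intro h
  have := DFunLike.congr_fun h ⟨0, by omega⟩
  simp [adjSwap, swap_apply_def, Fin.ext_iff] at this

theorem braidProj_surjective (n : ℕ) : Function.Surjective (braidProj n) := by
  obtain _ | n := n
  · exact fun g => ⟨1, Subsingleton.elim _ _⟩
  rw [← MonoidHom.range_eq_top, eq_top_iff]
  have h := Perm.mclosure_swap_castSucc_succ n
  have hle : Submonoid.closure (Set.range fun i : Fin n => swap i.castSucc i.succ) ≤
      (braidProj (n + 1)).range.toSubmonoid := by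
    rw [Submonoid.closure_le]
    rintro _ ⟨i, rfl⟩
    exact ⟨PresentedGroup.of i, braidProj_of (n := n + 1) i⟩
  intro g _
  exact hle (h ▸ Submonoid.mem_top g)

/-- A non-cyclic homomorphism sending the generators to transpositions is standard. -/
theorem conjHom_braidProj_of_isSwap {n : ℕ} (hn : 3 ≤ n) (hn4 : n ≠ 4)
    {f : BraidGroup n →* Perm (Fin n)} (hf : ¬ CyclicHom f)
    (hs : ∀ i < n - 1, (braidImage f i).IsSwap) : ConjHom f (braidProj n) := by
  rw [cyclicHom_iff hn] at hf
  obtain ⟨p, hp, hxp⟩ := (braidSeq_braidImage f).exists_chain (by omega) (by omega) hs hf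
  have hinj : Function.Injective fun i : Fin n => p i := fun i j hij =>
    Fin.ext (hp (by simp only [Set.mem_Iio]; omega) (by simp only [Set.mem_Iio]; omega) hij)
  -- The chain of `n - 1` transpositions visits `n` distinct letters, hence all of them, and this
  -- enumeration is the conjugator.
  let s : Perm (Fin n) := Equiv.ofBijective _ (Finite.injective_iff_bijective.1 hinj)
  refine ⟨s, DFunLike.congr_fun (f := f)
    (g := (MulAut.conj s).toMonoidHom.comp (braidProj n)) (PresentedGroup.ext fun i => ?_)⟩
  have h := hxp i i.2
  rw [braidImage_of_lt f i.2] at h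
  rw [h, MonoidHom.comp_apply, braidProj_of]
  change _ = s * swap _ _ * s⁻¹
  rw [← Equiv.swap_apply_apply]
  rfl

theorem isSwap_of_braid_three {a b : Perm (Fin 3)} (h : a * b * a = b * a * b) (hne : a ≠ b) :
    a.IsSwap := by
  rw [Perm.isSwap_iff_cycleType]
  revert a b
  decide +kernel

/-! ### Classification and the exceptional case of six strands -/

theorem isSwap_or_cycleType {n : ℕ} (hn : 3 ≤ n) (hn4 : n ≠ 4) {f : BraidGroup n →* Perm (Fin n)}
    (hf : ¬ CyclicHom f) : (∀ i < n - 1, (braidImage f i).IsSwap) ∨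
      n = 6 ∧ ∀ i < n - 1, (braidImage f i).cycleType = {2, 2, 2} := by
  rw [cyclicHom_iff hn] at hf
  have hx := braidSeq_braidImage f
  have hc : ∀ i < n - 1, (braidImage f i).cycleType = (braidImage f 0).cycleType := fun i hi =>
    (Perm.isConj_iff_cycleType_eq.1 (hx.isConj hi)).symm
  simp only [Perm.isSwap_iff_cycleType]
  obtain rfl | hn : n = 3 ∨ 5 ≤ n := by omega
  · left
    intro i hi
    rw [hc i hi, ← Perm.isSwap_iff_cycleType]
    exact isSwap_of_braid_three (hx.braid 0 (by omega)) hf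
  · obtain h | ⟨h6, h⟩ := hx.cycleType_zero (by omega) (by rw [Fintype.card_fin]; omega) hf
    · exact Or.inl fun i hi => (hc i hi).trans h
    · exact Or.inr ⟨by omega, fun i hi => (hc i hi).trans h⟩

theorem cyclicHom_of_lt {n k : ℕ} (hn : 3 ≤ n) (hn4 : n ≠ 4) (hk : k < n)
    (f : BraidGroup n →* Perm (Fin k)) : CyclicHom f := by
  rw [cyclicHom_iff hn]
  have hx := braidSeq_braidImage f
  obtain rfl | hn : n = 3 ∨ 5 ≤ n := by omega
  · refine eq_of_braid_of_commute (hx.braid 0 (by omega)) ?_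
    generalize braidImage f 0 = a, braidImage f 1 = b
    revert a b
    unfold Commute SemiconjBy
    interval_cases k <;> decide
  · exact hx.zero_eq_one_of_card_le (by omega) (by rw [Fintype.card_fin]; omega)

theorem cycleType_tripleSwap :
    (c[0, 1] * c[2, 3] * c[4, 5] : Perm (Fin 6)).cycleType = {2, 2, 2} := by
  decide +kernel

theorem cycleType_swap_zero_one : (c[0, 1] : Perm (Fin 6)).cycleType = {2} := by
  decide +kernel

theorem conj_swap_ne {α : MulAut (Perm (Fin 6))} (hs : α c[0, 1] = c[0, 1] * c[2, 3] * c[4, 5])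
    (s : Perm (Fin 6)) : α c[0, 1] ≠ s * c[0, 1] * s⁻¹ := by
  intro h
  have h2 := congrArg Perm.cycleType h
  rw [hs, Perm.cycleType_conj, cycleType_tripleSwap, cycleType_swap_zero_one] at h2
  revert h2
  decide

theorem not_cyclicHom_iff_of_ne_six {n : ℕ} (hn : 3 ≤ n) (hn4 : n ≠ 4) (hn6 : n ≠ 6)
    (f : BraidGroup n →* Perm (Fin n)) : ¬ CyclicHom f ↔ ConjHom f (braidProj n) := by
  refine ⟨fun hf => ?_, fun h => h.not_cyclicHom hn (not_cyclicHom_braidProj hn)⟩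
  exact conjHom_braidProj_of_isSwap hn hn4 hf
    ((isSwap_or_cycleType hn hn4 hf).resolve_right fun h => hn6 h.1)

theorem not_cyclicHom_six_iff {α : MulAut (Perm (Fin 6))}
    (hs : α c[0, 1] = c[0, 1] * c[2, 3] * c[4, 5]) (f : BraidGroup 6 →* Perm (Fin 6)) :
    ¬ CyclicHom f ↔
      ConjHom f (braidProj 6) ∨ ConjHom f (α.toMonoidHom.comp (braidProj 6)) := by
  have h6 : 3 ≤ 6 := by decide
  refine ⟨fun hf => ?_, ?_⟩
  · obtain h | ⟨-, h⟩ := isSwap_or_cycleType h6 (by decide) hf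
    · exact Or.inl (conjHom_braidProj_of_isSwap h6 (by decide) hf h)
    · right
      -- The inverse of `α` sends the class of triple transpositions to the class of transpositions,
      -- so composing `f` with it gives a conjugate of `π`.
      have hf' := (not_cyclicHom_comp_iff h6 f (g := α.symm.toMonoidHom) α.symm.injective).2 hf
      obtain ⟨s, hsx⟩ := conjHom_braidProj_of_isSwap h6 (by decide) hf' fun i hi => by
        have hc : IsConj (α c[0, 1]) (braidImage f i) := Perm.isConj_iff_cycleType_eq.2
          (by rw [h i hi, hs, cycleType_tripleSwap])
        have hc' := α.symm.toMonoidHom.map_isConj hc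
        rw [braidImage_of_lt _ hi] at hc' ⊢
        rw [MonoidHom.comp_apply, Perm.isSwap_iff_cycleType,
          ← Perm.isConj_iff_cycleType_eq.1 hc', ← cycleType_swap_zero_one]
        exact congrArg _ (α.symm_apply_apply _)
      refine ⟨α s, fun x => ?_⟩
      have := congrArg α (hsx x)
      rw [map_mul, map_mul, map_inv] at this
      exact (α.apply_symm_apply _).symm.trans this
  · rintro (h | h)
    · exact h.not_cyclicHom h6 (not_cyclicHom_braidProj h6)
    · exact h.not_cyclicHom h6
        ((not_cyclicHom_comp_iff h6 _ α.injective).2 (not_cyclicHom_braidProj h6))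

theorem not_conjHom_comp_braidProj {α : MulAut (Perm (Fin 6))}
    (hs : α c[0, 1] = c[0, 1] * c[2, 3] * c[4, 5]) :
    ¬ ConjHom (α.toMonoidHom.comp (braidProj 6)) (braidProj 6) := by
  rintro ⟨s, hsx⟩
  obtain ⟨x, hx⟩ := braidProj_surjective 6 c[0, 1]
  have := hsx x
  rw [MonoidHom.comp_apply, hx] at this
  exact conj_swap_ne hs s this

/-- Apply the classification to `β ∘ π`, which is non-cyclic. Since `π` is surjective, a conjugacy
of homomorphisms from `B_6` descends to one of automorphisms, and conjugacy to `π` itself would make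
`β` inner. -/
theorem conjHom_of_not_isInnerAut {α : MulAut (Perm (Fin 6))}
    (hs : α c[0, 1] = c[0, 1] * c[2, 3] * c[4, 5]) {β : MulAut (Perm (Fin 6))}
    (hβ : ¬ IsInnerAut β) : ConjHom β.toMonoidHom α.toMonoidHom := by
  have h6 : 3 ≤ 6 := by decide
  obtain ⟨s, h⟩ | ⟨s, h⟩ := (not_cyclicHom_six_iff hs (β.toMonoidHom.comp (braidProj 6))).1
    ((not_cyclicHom_comp_iff h6 _ β.injective).2 (not_cyclicHom_braidProj h6))
  · refine absurd ⟨s, MulEquiv.ext fun g => ?_⟩ hβ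
    obtain ⟨x, rfl⟩ := braidProj_surjective 6 g
    exact h x
  · refine ⟨s, fun g => ?_⟩
    obtain ⟨x, rfl⟩ := braidProj_surjective 6 g
    exact h x

theorem mainTheorem4 :
    -- for `n ≥ 3`, `n ≠ 4, 6`: non-cyclic homomorphisms `B_n → S_n` are the conjugates of `π`
    (∀ n : ℕ, 3 ≤ n → n ≠ 4 → n ≠ 6 → ∀ f : BraidGroup n →* Equiv.Perm (Fin n),
      ¬ CyclicHom f ↔ ConjHom f (braidProj n)) ∧
    -- for `n ≥ 3`, `n ≠ 4` and `k < n`: homomorphisms `B_n → S_k` are cyclic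
    (∀ n k : ℕ, 3 ≤ n → n ≠ 4 → k < n →
      ∀ f : BraidGroup n →* Equiv.Perm (Fin k), CyclicHom f) ∧
    -- the outer automorphism of `S_6` given by `(1,2) ↦ (1,2)(3,4)(5,6)` and
    -- `(1,2,3,4,5,6) ↦ (1,2,3)(4,5)` (the letters are numbered from `0` below)
    (∃! α : MulAut (Equiv.Perm (Fin 6)),
      α c[0, 1] = c[0, 1] * c[2, 3] * c[4, 5] ∧
      α c[0, 1, 2, 3, 4, 5] = c[0, 1, 2] * c[3, 4]) ∧
    (∀ α : MulAut (Equiv.Perm (Fin 6)),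
      α c[0, 1] = c[0, 1] * c[2, 3] * c[4, 5] →
      α c[0, 1, 2, 3, 4, 5] = c[0, 1, 2] * c[3, 4] →
      -- it is outer, and up to conjugation it is the only one
      ¬ IsInnerAut α ∧
      (∀ β : MulAut (Equiv.Perm (Fin 6)), ¬ IsInnerAut β →
        ConjHom β.toMonoidHom α.toMonoidHom) ∧
      -- it yields the only exceptional homomorphism `B_6 → S_6` up to conjugation
      (∀ f : BraidGroup 6 →* Equiv.Perm (Fin 6),
        ¬ CyclicHom f ↔
          ConjHom f (braidProj 6) ∨ ConjHom f (α.toMonoidHom.comp (braidProj 6))) ∧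
      ¬ ConjHom (α.toMonoidHom.comp (braidProj 6)) (braidProj 6)) := by
  refine ⟨fun n hn hn4 hn6 => not_cyclicHom_iff_of_ne_six hn hn4 hn6,
    fun n k hn hn4 hk => cyclicHom_of_lt hn hn4 hk, ?_, fun α hs _ => ⟨?_, ?_, ?_, ?_⟩⟩
  · obtain ⟨α, hs, hr⟩ := exists_mulAut_six
    refine ⟨α, ⟨hs, hr⟩, fun β hβ => MulEquiv.toMonoidHom_injective ?_⟩
    exact MonoidHom.eq_of_eq_on_swap_rotate_six (hβ.1.trans hs.symm) (hβ.2.trans hr.symm)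
  · rintro ⟨s, rfl⟩
    exact conj_swap_ne hs s rfl
  · exact fun β => conjHom_of_not_isInnerAut hs
  · exact not_cyclicHom_six_iff hs
  · exact not_conjHom_comp_braidProj hs
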